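/- For a linear map $T:\mathbb{R}^n\to\mathbb{R}^m$ with nonzero singular values $s_1\ge s_2\ge\dots\ge s_r>0$, $r\ge 1$, put $\|T\|_{S_p}=(\sum_{i=1}^r s_i^p)^{1/p}$ for $0<p<\infty$ and $\|T\|_{S_\infty}=s_1$, and for $2<q\le\infty$ let $$\mathrm{srank}_q(T)=\left(\frac{\|T\|_{S_2}}{\|T\|_{S_q}}\right)^{\frac{2q}{q-2}},$$ the exponent being read as $2$ for $q=\infty$. A random vector $X$ in $\mathbb{R}^n$ satisfies the small ball assumption (SBA) with constant $L>0$ if for every $1\le k\le n-1$, every $k$-dimensional subspace $F\subset\mathbb{R}^n$, every $z\in\mathbb{R}^n$ and every $\varepsilon>0$, $$\mathbb{P}\big(\|P_FX-z\|_2\le\varepsilon\sqrt{k}\big)\le(L\varepsilon)^k,$$ where $P_F$ is the orthogonal projection onto $F$. Let $G$ denote the standard Gaussian random vector in $\mathbb{R}^n$. **Theorem 1.8.** There are absolute constants $c,c'>0$, and for every $2<q\le\infty$ there are constants $c_q,c_q'>0$ that depend only on $q$, such that the following holds. Let $T:\mathbb{R}^n\to\mathbb{R}^m$ be a linear map with $\mathrm{rank}(T)=m\ge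 1$. 1. For every real $0<k\le c_q\,\mathrm{srank}_q(T)$, $$\left(\mathbb{E}\|TG\|_2^{-k}\right)^{-1/k}\ge c\,\|T\|_{S_2};$$ in particular the expectation is finite. 2. If $n\ge 2$ and $X$ is a random vector in $\mathbb{R}^n$ that satisfies the SBA with constant $L$, then for every $\varepsilon>0$, $$\mathbb{P}\left(\|TX\|_2\le\frac{\varepsilon}{2eL}\|T\|_{S_2}\right)\le(c'\varepsilon)^{c_q'\,\mathrm{srank}_q(T)}.$$ -/

import Mathlib

open MeasureTheory ProbabilityTheory
open scoped ENNReal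

noncomputable section

namespace SmallBall

/-- The random vector `X` in `ℝⁿ`, defined on the probability space `(Ω, P)`, satisfies the small
ball assumption with constant `L`: for all `1 ≤ k ≤ n - 1`, all `k`-dimensional subspaces `F`, all
`z ∈ ℝⁿ` and all `ε > 0`, one has `P (‖P_F X - z‖₂ ≤ ε √k) ≤ (L ε) ^ k`, where `P_F` is the
orthogonal projection onto `F`. -/
def SBA {n : ℕ} {Ω : Type*} [MeasurableSpace Ω] (P : Measure Ω)
    (X : Ω → EuclideanSpace ℝ (Fin n)) (L : ℝ) : Prop :=
  ∀ k : ℕ, 1 ≤ k → k < n →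
    ∀ F : Submodule ℝ (EuclideanSpace ℝ (Fin n)), Module.finrank ℝ F = k →
      ∀ z : EuclideanSpace ℝ (Fin n), ∀ ε : ℝ, 0 < ε →
        P.real {ω | ‖F.starProjection (X ω) - z‖ ≤ ε * √(k : ℝ)} ≤ (L * ε) ^ k

/-- The Schatten norm `‖T‖_{S_p}`, `0 < p ≤ ∞`: the `ℓ_p` norm of the nonzero singular values of
`T`. The singular values are listed in non-increasing order starting from index `0`, the nonzero
ones being those of index `< rank T`; hence `‖T‖_{S_∞}` is the one of index `0`. -/
def schattenNorm {n m : ℕ} (T : EuclideanSpace ℝ (Fin n) →ₗ[ℝ] EuclideanSpace ℝ (Fin m))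
    (p : ℝ≥0∞) : ℝ :=
  if p = ∞ then T.singularValues 0
  else (∑ i ∈ Finset.range (Module.finrank ℝ (LinearMap.range T)),
    T.singularValues i ^ p.toReal) ^ (1 / p.toReal)

/-- The exponent `2q / (q - 2)`, read as its limit `2` for `q = ∞`. -/
def srankExponent (q : ℝ≥0∞) : ℝ :=
  if q = ∞ then 2 else 2 * q.toReal / (q.toReal - 2)

/-- The `q`-stable rank `(‖T‖_{S_2} / ‖T‖_{S_q}) ^ (2q / (q - 2))` of a nonzero `T`,
for `2 < q ≤ ∞`. -/
def srank {n m : ℕ} (q : ℝ≥0∞)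
    (T : EuclideanSpace ℝ (Fin n) →ₗ[ℝ] EuclideanSpace ℝ (Fin m)) : ℝ :=
  (schattenNorm T 2 / schattenNorm T q) ^ srankExponent q

/-- The negative moment `(𝔼 ‖T G‖₂ ^ (-k)) ^ (-1/k)`, `k > 0`, with `G` the standard Gaussian
vector in `ℝⁿ`. It is computed in `[0, ∞]`, so it is `0` exactly when the expectation is
infinite. -/
def gaussianNegMoment {n m : ℕ}
    (T : EuclideanSpace ℝ (Fin n) →ₗ[ℝ] EuclideanSpace ℝ (Fin m)) (k : ℝ) : ℝ≥0∞ :=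
  (∫⁻ x, ‖T x‖ₑ ^ (-k) ∂(stdGaussian (EuclideanSpace ℝ (Fin n)))) ^ (-1 / k)

end SmallBall

end

/-! By the singular value decomposition, `‖T x‖²` is the sum of `sᵢ² ⟨bᵢ, x⟩²` for an orthonormal
basis `b`. Cut the indices into consecutive blocks of length `N` and let `Yⱼ` be the norm of the
projection of `X` onto block `j`. Replacing each `sᵢ` by the smallest one in its block gives `‖T X‖²
≥ ∑ⱼ wⱼ Yⱼ²`. Each `Yⱼ` obeys an `N`-dimensional small ball estimate, hence has a controlled moment
of order `-N/2`. Jensen's inequality passes this bound to the weighted average, with no independence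
between blocks (`lintegral_rpow_neg_le_of_weighted_sum`).

It remains to bound `∑ⱼ wⱼ` below. By monotonicity, `N wⱼ` dominates the sum of `sᵢ²` over block `j
+ 1`, so only the first block is lost. Hölder's inequality shows that the first `N` squares make up
at most half of `‖T‖²_{S₂}` when `N` is a small multiple of the stable rank (`exists_block_length`).
The result is `𝔼 ‖T X‖^(-N/2) ≤ (6L / ‖T‖_{S₂})^(N/2)`. Monotonicity of moments then gives the
Gaussian claim, and Markov's inequality the probability bound. -/

/-! ### Negative moments from small ball estimates -/

/-- Positivity has to be tracked separately: real powers satisfy `0 ^ (-k) = 0` for `k ≠ 0`, so a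
bound on a real negative moment does not see the event `Y = 0`. -/
theorem ae_pos_of_smallBall {Ω : Type*} [MeasurableSpace Ω] {P : Measure Ω}
    [IsProbabilityMeasure P] {Y : Ω → ℝ} {N : ℕ} (hN : N ≠ 0) {L : ℝ}
    (h : ∀ ε : ℝ, 0 < ε → P.real {ω | Y ω ≤ ε * √(N : ℝ)} ≤ (L * ε) ^ N) :
    ∀ᵐ ω ∂P, 0 < Y ω := by
  have h0 : P.real {ω | Y ω ≤ 0} ≤ 0 := by
    have ht : Filter.Tendsto (fun ε : ℝ => (L * ε) ^ N) (nhdsWithin 0 (Set.Ioi 0)) (nhds 0) := by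
      have : Continuous (fun ε : ℝ => (L * ε) ^ N) := by fun_prop
      have h1 := this.tendsto 0
      simp only [mul_zero, zero_pow hN] at h1
      exact h1.mono_left nhdsWithin_le_nhds
    refine ge_of_tendsto ht ?_
    filter_upwards [self_mem_nhdsWithin] with ε hε
    refine le_trans (measureReal_mono ?_) (h ε hε)
    intro ω hω
    have : 0 ≤ ε * √(N : ℝ) := mul_nonneg (le_of_lt hε) (Real.sqrt_nonneg _)
    exact le_trans hω this
  have h1 : P {ω | Y ω ≤ 0} = 0 :=
    (measureReal_eq_zero_iff).1 (le_antisymm h0 measureReal_nonneg)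
  rw [ae_iff]
  simpa using h1

theorem lintegral_Ioi_inv_sq_tail {M : ℝ} (hM : 0 < M) :
    ∫⁻ t in Set.Ioi M, ENNReal.ofReal (M ^ 2 * t ^ (-2 : ℝ)) = ENNReal.ofReal M := by
  rw [← ofReal_integral_eq_lintegral_ofReal]
  · rw [integral_const_mul, integral_Ioi_rpow_of_lt (by norm_num) hM]
    congr 1
    norm_num [Real.rpow_neg_one]
    field_simp
  · exact (integrableOn_Ioi_rpow_of_lt (by norm_num) hM).const_mul _
  · filter_upwards [ae_restrict_mem measurableSet_Ioi] with t ht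
    have : 0 < t := hM.trans ht
    positivity

/-- Layer cake formula, split at `M`: the probability is at most `1` below and at most the quadratic
tail above, and each part contributes `M`. -/
theorem lintegral_le_of_meas_le_sq {Ω : Type*} [MeasurableSpace Ω] {P : Measure Ω}
    [IsProbabilityMeasure P] {f : Ω → ℝ} (hf : AEMeasurable f P) (hf0 : ∀ ω, 0 ≤ f ω)
    {M : ℝ} (hM : 0 < M)
    (h : ∀ t : ℝ, 0 < t → P.real {ω | t ≤ f ω} ≤ M ^ 2 * t ^ (-2 : ℝ)) :
    ∫⁻ ω, ENNReal.ofReal (f ω) ∂P ≤ ENNReal.ofReal (2 * M) := by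
  rw [lintegral_eq_lintegral_meas_le P (Filter.Eventually.of_forall hf0) hf,
    ← Set.Ioc_union_Ioi_eq_Ioi hM.le]
  refine (lintegral_union_le _ _ _).trans ?_
  rw [two_mul, ENNReal.ofReal_add hM.le hM.le]
  refine add_le_add ?_ ?_
  · calc ∫⁻ t in Set.Ioc 0 M, P {ω | t ≤ f ω} ≤ ∫⁻ t in Set.Ioc 0 M, 1 :=
          lintegral_mono fun _ => prob_le_one
      _ = ENNReal.ofReal M := by simp
  · rw [← lintegral_Ioi_inv_sq_tail hM]
    refine setLIntegral_mono' measurableSet_Ioi fun t ht => ?_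
    have ht0 : 0 < t := hM.trans ht
    rw [← ofReal_measureReal]
    exact ENNReal.ofReal_le_ofReal (h t ht0)

/-- Taking half of the small ball exponent `N` makes the tail of `Y ^ (-N/2)` decay like `t ^ (-2)`,
which is integrable at infinity. -/
theorem lintegral_rpow_neg_le_of_smallBall {Ω : Type*} [MeasurableSpace Ω] {P : Measure Ω}
    [IsProbabilityMeasure P] {Y : Ω → ℝ} (hY : AEMeasurable Y P) (hY0 : ∀ ω, 0 ≤ Y ω)
    {N : ℕ} (hN : N ≠ 0) {L : ℝ} (hL : 0 < L)
    (h : ∀ ε : ℝ, 0 < ε → P.real {ω | Y ω ≤ ε * √(N : ℝ)} ≤ (L * ε) ^ N) :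
    ∫⁻ ω, ENNReal.ofReal (Y ω ^ (-(N / 2 : ℝ))) ∂P ≤
      ENNReal.ofReal (2 * (L / √(N : ℝ)) ^ (N / 2 : ℝ)) := by
  have hN0 : (0 : ℝ) < N := by positivity
  have hs : 0 < √(N : ℝ) := Real.sqrt_pos.2 hN0
  have hk : (0 : ℝ) < N / 2 := by positivity
  have hLN : 0 < L / √(N : ℝ) := by positivity
  refine lintegral_le_of_meas_le_sq (hY.pow_const _) (fun ω => Real.rpow_nonneg (hY0 ω) _)
    (Real.rpow_pos_of_pos hLN _) fun t ht => ?_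
  have hu : 0 < t ^ (-(1 / (N / 2 : ℝ))) := Real.rpow_pos_of_pos ht _
  have hsub : {ω | t ≤ Y ω ^ (-(N / 2 : ℝ))} ⊆
      {ω | Y ω ≤ (t ^ (-(1 / (N / 2 : ℝ))) / √(N : ℝ)) * √(N : ℝ)} := by
    intro ω hω
    simp only [Set.mem_ofPred_eq] at hω ⊢
    rw [div_mul_cancel₀ _ hs.ne']
    rcases (hY0 ω).eq_or_lt with h0 | hpos
    · rw [← h0]; exact hu.le
    · have := Real.rpow_le_rpow_of_nonpos ht hω (z := -(1 / (N / 2 : ℝ)))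
        (by rw [neg_nonpos]; positivity)
      rwa [← Real.rpow_mul hpos.le, neg_mul_neg, mul_one_div_cancel hk.ne', Real.rpow_one] at this
  refine (measureReal_mono hsub).trans ((h _ (by positivity)).trans_eq ?_)
  have e1 : L * (t ^ (-(1 / (N / 2 : ℝ))) / √(N : ℝ)) =
      (L / √(N : ℝ)) * t ^ (-(1 / (N / 2 : ℝ))) := by ring
  rw [e1, mul_pow]
  congr 1
  · rw [← Real.rpow_natCast ((L / √(N : ℝ)) ^ (N / 2 : ℝ)), ← Real.rpow_mul hLN.le,
      ← Real.rpow_natCast]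
    congr 1
    push_cast; ring
  · rw [← Real.rpow_natCast, ← Real.rpow_mul ht.le]
    congr 1
    field_simp

/-- Jensen's inequality for the convex function `x ↦ x ^ (-p)`. -/
theorem rpow_neg_sum_le {ι : Type*} (s : Finset ι) (w z : ι → ℝ) (hw : ∀ i ∈ s, 0 ≤ w i)
    (hw1 : ∑ i ∈ s, w i = 1) (hz : ∀ i ∈ s, 0 < z i) {p : ℝ} (hp : 0 ≤ p) :
    (∑ i ∈ s, w i * z i) ^ (-p) ≤ ∑ i ∈ s, w i * z i ^ (-p) := by
  -- AM-GM is used for `z` and for `z ^ (-p)`; the geometric mean commutes with the power `-p` and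
  -- links the two.
  have h1 := Real.geom_mean_le_arith_mean_weighted s w z hw hw1 fun i hi => (hz i hi).le
  have h2 := Real.geom_mean_le_arith_mean_weighted s w (fun i => z i ^ (-p)) hw hw1
    fun i hi => (Real.rpow_pos_of_pos (hz i hi) _).le
  have hpos : 0 < ∏ i ∈ s, z i ^ w i := Finset.prod_pos fun i hi => Real.rpow_pos_of_pos (hz i hi) _
  refine (Real.rpow_le_rpow_of_nonpos hpos h1 (neg_nonpos.2 hp)).trans (le_trans (le_of_eq ?_) h2)
  rw [← Real.finsetProd_rpow _ _ fun i hi => (Real.rpow_pos_of_pos (hz i hi) _).le]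
  refine Finset.prod_congr rfl fun i hi => ?_
  rw [← Real.rpow_mul (hz i hi).le, ← Real.rpow_mul (hz i hi).le, mul_comm]

theorem lintegral_rpow_neg_le_of_weighted_sum {Ω ι : Type*} [MeasurableSpace Ω] {P : Measure Ω}
    (s : Finset ι) (w : ι → ℝ) (Y : ι → Ω → ℝ) (V : Ω → ℝ)
    (hw : ∀ i ∈ s, 0 ≤ w i) {W : ℝ} (hW0 : 0 < W) (hW : W ≤ ∑ i ∈ s, w i)
    (hYm : ∀ i ∈ s, AEMeasurable (Y i) P) (hY : ∀ i ∈ s, ∀ᵐ ω ∂P, 0 < Y i ω)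
    (hV0 : ∀ ω, 0 ≤ V ω) (hV : ∀ ω, ∑ i ∈ s, w i * Y i ω ^ 2 ≤ V ω ^ 2)
    {k : ℝ} (hk : 0 < k) {M : ℝ≥0∞}
    (hM : ∀ i ∈ s, ∫⁻ ω, ENNReal.ofReal (Y i ω ^ (-k)) ∂P ≤ M) :
    (∀ᵐ ω ∂P, 0 < V ω) ∧
      ∫⁻ ω, ENNReal.ofReal (V ω ^ (-k)) ∂P ≤ ENNReal.ofReal (W ^ (-(k / 2))) * M := by
  set W' := ∑ i ∈ s, w i with hW'
  have hW'0 : 0 < W' := hW0.trans_le hW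
  have hae : ∀ᵐ ω ∂P, ∀ i ∈ s, 0 < Y i ω := (Filter.eventually_all_finset s).2 hY
  have hsum1 : ∑ i ∈ s, w i / W' = 1 := by rw [← Finset.sum_div, div_self hW'0.ne']
  have hw' : ∀ i ∈ s, 0 ≤ w i / W' := fun i hi => div_nonneg (hw i hi) hW'0.le
  have hlow : ∀ ω, W' * ∑ i ∈ s, w i / W' * Y i ω ^ 2 ≤ V ω ^ 2 := fun ω => by
    refine le_trans (le_of_eq ?_) (hV ω)
    rw [Finset.mul_sum]
    refine Finset.sum_congr rfl fun i _ => ?_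
    field_simp
  have hpos : ∀ ω, (∀ i ∈ s, 0 < Y i ω) → 0 < ∑ i ∈ s, w i / W' * Y i ω ^ 2 := fun ω hω => by
    obtain ⟨i, hi, hwi⟩ : ∃ i ∈ s, 0 < w i := by
      by_contra! hcon
      exact absurd (Finset.sum_nonpos hcon) (not_le.2 hW'0)
    refine Finset.sum_pos' (fun j hj => mul_nonneg (hw' j hj) (sq_nonneg _)) ⟨i, hi, ?_⟩
    exact mul_pos (div_pos hwi hW'0) (pow_pos (hω i hi) 2)
  have hVpos : ∀ ω, (∀ i ∈ s, 0 < Y i ω) → 0 < V ω := fun ω hω =>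
    (hV0 ω).lt_of_ne' fun h0 => by
      have := (mul_pos hW'0 (hpos ω hω)).trans_le (hlow ω)
      simp [h0] at this
  refine ⟨hae.mono hVpos, ?_⟩
  have hpt : ∀ ω, (∀ i ∈ s, 0 < Y i ω) →
      V ω ^ (-k) ≤ W ^ (-(k / 2)) * ∑ i ∈ s, w i / W' * Y i ω ^ (-k) := fun ω hω => by
    have e : V ω ^ (-k) = (V ω ^ 2) ^ (-(k / 2)) := by
      rw [← Real.rpow_natCast, ← Real.rpow_mul (hV0 ω)]
      congr 1; push_cast; ring
    rw [e]
    refine (Real.rpow_le_rpow_of_nonpos (mul_pos hW'0 (hpos ω hω)) (hlow ω) (by linarith)).trans ?_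
    rw [Real.mul_rpow hW'0.le (hpos ω hω).le]
    refine mul_le_mul (Real.rpow_le_rpow_of_nonpos hW0 hW (by linarith)) ?_
      (Real.rpow_nonneg (hpos ω hω).le _) (Real.rpow_nonneg hW0.le _)
    refine (rpow_neg_sum_le s (fun i => w i / W') (fun i => Y i ω ^ 2) hw' hsum1
      (fun i hi => pow_pos (hω i hi) 2) (by linarith : (0 : ℝ) ≤ k / 2)).trans_eq ?_
    refine Finset.sum_congr rfl fun i hi => ?_
    rw [← Real.rpow_natCast (Y i ω), ← Real.rpow_mul (hω i hi).le]
    congr 2; push_cast; ring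
  calc ∫⁻ ω, ENNReal.ofReal (V ω ^ (-k)) ∂P
      ≤ ∫⁻ ω, ENNReal.ofReal (W ^ (-(k / 2))) *
          ∑ i ∈ s, ENNReal.ofReal (w i / W') * ENNReal.ofReal (Y i ω ^ (-k)) ∂P := by
        refine lintegral_mono_ae (hae.mono fun ω hω => ?_)
        refine (ENNReal.ofReal_le_ofReal (hpt ω hω)).trans_eq ?_
        rw [ENNReal.ofReal_mul (Real.rpow_nonneg hW0.le _), ENNReal.ofReal_sum_of_nonneg
          fun i hi => mul_nonneg (hw' i hi) (Real.rpow_nonneg (hω i hi).le _)]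
        congr 1
        exact Finset.sum_congr rfl fun i hi => ENNReal.ofReal_mul (hw' i hi)
    _ = ENNReal.ofReal (W ^ (-(k / 2))) *
          ∑ i ∈ s, ENNReal.ofReal (w i / W') * ∫⁻ ω, ENNReal.ofReal (Y i ω ^ (-k)) ∂P := by
        rw [lintegral_const_mul' _ _ ENNReal.ofReal_ne_top, lintegral_finsetSum']
        · congr 1
          exact Finset.sum_congr rfl fun i hi => lintegral_const_mul' _ _ ENNReal.ofReal_ne_top
        · exact fun i hi => (((hYm i hi).pow_const _).ennreal_ofReal).const_mul _
    _ ≤ ENNReal.ofReal (W ^ (-(k / 2))) * ∑ i ∈ s, ENNReal.ofReal (w i / W') * M := by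
        gcongr with i hi
        exact hM i hi
    _ = ENNReal.ofReal (W ^ (-(k / 2))) * M := by
        rw [← Finset.sum_mul, ← ENNReal.ofReal_sum_of_nonneg hw', hsum1, ENNReal.ofReal_one,
          one_mul]

/-! ### Small ball estimates for blocks of coordinates -/

theorem integral_exp_neg_mul_sq_gaussianReal {l : ℝ} (hl : 0 < l) :
    ∫ x, Real.exp (-l * x ^ 2) ∂(gaussianReal 0 1) = (√(1 + 2 * l))⁻¹ := by
  rw [integral_gaussianReal_eq_integral_smul one_ne_zero]
  have e : ∀ x : ℝ, gaussianPDFReal 0 1 x • Real.exp (-l * x ^ 2) =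
      (√(2 * Real.pi))⁻¹ * Real.exp (-(l + 1 / 2) * x ^ 2) := fun x => by
    simp only [gaussianPDFReal, smul_eq_mul, NNReal.coe_one, sub_zero, mul_one]
    rw [mul_assoc, ← Real.exp_add]
    congr 2; ring
  simp_rw [e]
  rw [integral_const_mul, integral_gaussian, ← Real.sqrt_inv, ← Real.sqrt_inv,
    ← Real.sqrt_mul (by positivity)]
  congr 1
  field_simp
  ring

/-- Markov's inequality for `exp (-l ∑ xᵢ²)`, whose mean factors over the coordinates. -/
theorem pi_gaussianReal_smallBall {ι : Type*} [Fintype ι] (B : Finset ι) {ε : ℝ} (hε : 0 < ε) :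
    (Measure.pi fun _ : ι => gaussianReal 0 1).real
      {x | ∑ i ∈ B, x i ^ 2 ≤ ε ^ 2 * B.card} ≤ (√(Real.exp 1) * ε) ^ B.card := by
  classical
  set μ := Measure.pi fun _ : ι => gaussianReal 0 1
  -- This choice makes `exp (l ε²) = √e`, while `(1 + 2l) ^ (-1/2) ≤ ε`.
  set l : ℝ := 1 / (2 * ε ^ 2) with hl
  have hl0 : 0 < l := by positivity
  set g : ι → ℝ → ℝ := fun i t => if i ∈ B then Real.exp (-l * t ^ 2) else 1 with hg
  have hprod : ∀ x : ι → ℝ, ∏ i, g i (x i) = Real.exp (-l * ∑ i ∈ B, x i ^ 2) := fun x => by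
    simp only [hg]
    rw [Finset.prod_ite_mem, Finset.univ_inter, ← Real.exp_sum, Finset.mul_sum]
  have hint : ∫ x, Real.exp (-l * ∑ i ∈ B, x i ^ 2) ∂μ = ((√(1 + 2 * l))⁻¹) ^ B.card := by
    simp_rw [← hprod]
    rw [integral_fintype_prod_eq_prod g, ← Finset.prod_const, ← Finset.univ_inter B,
      ← Finset.prod_ite_mem]
    refine Finset.prod_congr rfl fun i _ => ?_
    by_cases hi : i ∈ B
    · simp only [hg, hi, if_true]
      exact integral_exp_neg_mul_sq_gaussianReal hl0
    · simp [hg, hi]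
  have hbd : Integrable (fun x : ι → ℝ => Real.exp (-l * ∑ i ∈ B, x i ^ 2)) μ := by
    refine Integrable.of_bound (Continuous.aestronglyMeasurable (by fun_prop)) 1 (Filter.Eventually.of_forall fun x => ?_)
    rw [Real.norm_of_nonneg (Real.exp_pos _).le, Real.exp_le_one_iff, neg_mul, neg_nonpos]
    exact mul_nonneg hl0.le (Finset.sum_nonneg fun i _ => sq_nonneg _)
  have hmar := mul_meas_ge_le_integral_of_nonneg
    (Filter.Eventually.of_forall fun x => (Real.exp_pos _).le) hbd
    (Real.exp (-l * (ε ^ 2 * B.card)))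
  rw [hint] at hmar
  have hset : {x : ι → ℝ | Real.exp (-l * (ε ^ 2 * B.card)) ≤ Real.exp (-l * ∑ i ∈ B, x i ^ 2)} =
      {x | ∑ i ∈ B, x i ^ 2 ≤ ε ^ 2 * B.card} := by
    ext x
    simp only [Set.mem_ofPred_eq, Real.exp_le_exp, neg_mul, neg_le_neg_iff]
    exact mul_le_mul_iff_right₀ hl0
  rw [hset] at hmar
  have h1 : Real.exp (-l * (ε ^ 2 * B.card)) = ((√(Real.exp 1))⁻¹) ^ B.card := by
    rw [← Real.sqrt_inv, ← Real.exp_neg, Real.sqrt_eq_rpow, ← Real.exp_mul, ← Real.exp_nat_mul]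
    congr 1
    rw [hl]; field_simp
  have h2 : (√(1 + 2 * l))⁻¹ ≤ ε := by
    rw [inv_le_comm₀ (by positivity) hε]
    apply Real.le_sqrt_of_sq_le
    rw [hl]; field_simp; linarith [sq_nonneg ε]
  rw [h1, inv_pow, inv_mul_le_iff₀ (by positivity)] at hmar
  refine hmar.trans ?_
  rw [mul_pow]
  gcongr

theorem stdGaussian_smallBall {ι E : Type*} [Fintype ι] [NormedAddCommGroup E]
    [InnerProductSpace ℝ E] [FiniteDimensional ℝ E] [MeasurableSpace E] [BorelSpace E]
    (b : OrthonormalBasis ι ℝ E) (B : Finset ι) {ε : ℝ} (hε : 0 < ε) :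
    (stdGaussian E).real {x | √(∑ i ∈ B, inner ℝ (b i) x ^ 2) ≤ ε * √(B.card : ℝ)} ≤
      (√(Real.exp 1) * ε) ^ B.card := by
  refine le_trans (le_of_eq ?_) (pi_gaussianReal_smallBall B hε)
  have hm : MeasurableSet {x : E | √(∑ i ∈ B, inner ℝ (b i) x ^ 2) ≤ ε * √(B.card : ℝ)} :=
    measurableSet_le (by fun_prop) measurable_const
  rw [stdGaussian_eq_map_pi_orthonormalBasis b, map_measureReal_apply (by fun_prop) hm]
  congr 1
  ext x
  have hin : ∀ i, inner ℝ (b i) (∑ j, x j • b j) = x i := fun i => by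
    rw [← b.repr_apply_apply, b.sum_repr_symm, LinearIsometryEquiv.apply_symm_apply]
  simp only [Set.mem_preimage, Set.mem_ofPred_eq, hin]
  rw [Real.sqrt_le_left (by positivity), mul_pow, Real.sq_sqrt (by positivity)]

namespace SmallBall

theorem SBA.coordinates {n : ℕ} {Ω : Type*} [MeasurableSpace Ω] {P : Measure Ω}
    {X : Ω → EuclideanSpace ℝ (Fin n)} {L : ℝ} (h : SBA P X L)
    (b : OrthonormalBasis (Fin n) ℝ (EuclideanSpace ℝ (Fin n))) (B : Finset (Fin n))
    (hB : B.card ≠ 0) (hBn : B.card < n) {ε : ℝ} (hε : 0 < ε) :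
    P.real {ω | √(∑ i ∈ B, inner ℝ (b i) (X ω) ^ 2) ≤ ε * √(B.card : ℝ)} ≤
      (L * ε) ^ B.card := by
  classical
  set F := Submodule.span ℝ (B.image b : Set (EuclideanSpace ℝ (Fin n))) with hF
  set u := OrthonormalBasis.span b.orthonormal B
  have hdim : Module.finrank ℝ F = B.card := by
    rw [Module.finrank_eq_card_basis u.toBasis, Fintype.card_coe]
  refine le_trans (le_of_eq ?_) (h B.card (Nat.one_le_iff_ne_zero.2 hB) hBn F hdim 0 ε hε)
  congr 1
  ext ω
  have hn : ‖F.starProjection (X ω)‖ ^ 2 = ∑ i ∈ B, inner ℝ (b i) (X ω) ^ 2 := by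
    have h1 : ‖F.starProjection (X ω)‖ = ‖F.orthogonalProjectionOnto (X ω)‖ := rfl
    rw [h1, ← u.sum_sq_inner_right, ← Finset.sum_coe_sort B]
    refine Finset.sum_congr rfl fun i _ => ?_
    rw [Submodule.inner_orthogonalProjectionOnto_eq_of_mem_left, OrthonormalBasis.span_apply]
  simp only [Set.mem_ofPred_eq, sub_zero, ← hn, Real.sqrt_sq (norm_nonneg _)]

end SmallBall

/-! ### Singular value decomposition and sums over blocks -/

/-- The singular value decomposition, in the form of the identity for `‖T x‖ ^ 2`. -/
theorem LinearMap.exists_orthonormalBasis_norm_sq_apply {n : ℕ} {E F : Type*}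
    [NormedAddCommGroup E] [InnerProductSpace ℝ E] [FiniteDimensional ℝ E]
    [NormedAddCommGroup F] [InnerProductSpace ℝ F] [FiniteDimensional ℝ F]
    (hn : Module.finrank ℝ E = n) (T : E →ₗ[ℝ] F) :
    ∃ b : OrthonormalBasis (Fin n) ℝ E, ∀ x,
      ‖T x‖ ^ 2 = ∑ i : Fin n, T.singularValues i ^ 2 * inner ℝ (b i) x ^ 2 := by
  have hT := T.isSymmetric_adjoint_comp_self
  refine ⟨hT.eigenvectorBasis hn, fun x => ?_⟩
  set b := hT.eigenvectorBasis hn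
  have h1 : ‖T x‖ ^ 2 = inner ℝ ((LinearMap.adjoint T ∘ₗ T) x) x := by
    rw [LinearMap.comp_apply, LinearMap.adjoint_inner_left, real_inner_self_eq_norm_sq]
  rw [h1, ← b.sum_inner_mul_inner]
  refine Finset.sum_congr rfl fun i _ => ?_
  rw [T.sq_singularValues_fin hn, hT x (b i), hT.apply_eigenvectorBasis hn i, inner_smul_right,
    real_inner_comm]
  change hT.eigenvalues hn i * inner ℝ (b i) x * inner ℝ (b i) x = _
  ring

/-- Every term of a block is at most the last term of the preceding block. -/
theorem sum_range_le_sum_head_add_blocks {a : ℕ → ℝ} (ha : Antitone a) (N J : ℕ) :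
    ∑ i ∈ Finset.range ((J + 1) * N), a i ≤
      ∑ i ∈ Finset.range N, a i + ∑ j ∈ Finset.range J, N * a ((j + 1) * N - 1) := by
  induction J with
  | zero => simp
  | succ J ih =>
    rw [add_mul (J + 1), one_mul, Finset.sum_range_add, Finset.sum_range_succ _ J, ← add_assoc]
    refine add_le_add ih ?_
    calc ∑ x ∈ Finset.range N, a ((J + 1) * N + x)
        ≤ ∑ x ∈ Finset.range N, a ((J + 1) * N - 1) :=
          Finset.sum_le_sum fun x _ => ha (by omega)
      _ = N * a ((J + 1) * N - 1) := by simp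

theorem sum_range_le_sum_head_add_div_blocks {a : ℕ → ℝ} (ha : Antitone a) (ha0 : ∀ i, 0 ≤ a i)
    (N m : ℕ) (hN : N ≠ 0) :
    ∑ i ∈ Finset.range m, a i ≤
      ∑ i ∈ Finset.range N, a i + ∑ j ∈ Finset.range (m / N), N * a ((j + 1) * N - 1) := by
  refine le_trans ?_ (sum_range_le_sum_head_add_blocks ha N (m / N))
  refine Finset.sum_le_sum_of_subset_of_nonneg ?_ fun i _ _ => ha0 i
  rw [Finset.range_subset_range, add_mul, one_mul, mul_comm]
  have := Nat.div_add_mod m N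
  have := Nat.mod_lt m (Nat.pos_of_ne_zero hN)
  omega

theorem Nat.div_eq_iff_mul_le_and_lt {x N j : ℕ} (hN : N ≠ 0) :
    x / N = j ↔ j * N ≤ x ∧ x < (j + 1) * N := by
  have hN' := Nat.pos_of_ne_zero hN
  rw [← Nat.le_div_iff_mul_le hN', ← Nat.div_lt_iff_lt_mul hN']
  omega

theorem Fin.card_filter_div_eq {n N j : ℕ} (hN : N ≠ 0) (h : (j + 1) * N ≤ n) :
    (Finset.univ.filter fun i : Fin n => (i : ℕ) / N = j).card = N := by
  have : (Finset.univ.filter fun i : Fin n => (i : ℕ) / N = j).map Fin.valEmbedding =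
      Finset.Ico (j * N) ((j + 1) * N) := by
    ext x
    simp only [Finset.mem_map, Finset.mem_filter, Finset.mem_univ, true_and, Fin.valEmbedding_apply,
      Finset.mem_Ico]
    constructor
    · rintro ⟨i, hi, rfl⟩
      exact (Nat.div_eq_iff_mul_le_and_lt hN).1 hi
    · intro hx
      exact ⟨⟨x, hx.2.trans_le h⟩, (Nat.div_eq_iff_mul_le_and_lt hN).2 hx, rfl⟩
  rw [← Finset.card_map, this, Nat.card_Ico, add_mul, one_mul, Nat.add_sub_cancel_left]

theorem sum_blocks_le_sum {a : ℕ → ℝ} (ha : Antitone a) (ha0 : ∀ i, 0 ≤ a i) {n : ℕ} (N J : ℕ)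
    (hN : N ≠ 0) (y : Fin n → ℝ) (hy : ∀ i, 0 ≤ y i) :
    ∑ j ∈ Finset.range J, a ((j + 1) * N - 1) *
        ∑ i ∈ Finset.univ.filter (fun i : Fin n => (i : ℕ) / N = j), y i ≤
      ∑ i : Fin n, a i * y i := by
  calc _ ≤ ∑ j ∈ Finset.range J,
        ∑ i ∈ Finset.univ.filter (fun i : Fin n => (i : ℕ) / N = j), a i * y i := by
        refine Finset.sum_le_sum fun j _ => ?_
        rw [Finset.mul_sum]
        refine Finset.sum_le_sum fun i hi => mul_le_mul_of_nonneg_right (ha ?_) (hy i)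
        have := ((Nat.div_eq_iff_mul_le_and_lt hN).1 (Finset.mem_filter.1 hi).2).2
        omega
    _ ≤ _ := Finset.sum_fiberwise_le_sum_of_sum_fiber_nonneg fun j _ =>
        Finset.sum_nonneg fun i _ => mul_nonneg (ha0 _) (hy i)

/-! ### Negative moments of `‖T X‖` and their consequences -/

theorem negMoment_constant_le {L S N : ℝ} (hL : 0 < L) (hS : 0 < S) (hN : 1 ≤ N) :
    (S ^ 2 / (2 * N)) ^ (-(N / 2 / 2)) * (2 * (L / √N) ^ (N / 2)) ≤ (6 * L / S) ^ (N / 2) := by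
  have hN0 : 0 < N := by linarith
  have e1 : (S ^ 2 / (2 * N)) ^ (-(N / 2 / 2)) = (√2 * √N / S) ^ (N / 2) := by
    have : S ^ 2 / (2 * N) = (√2 * √N / S) ^ (-2 : ℝ) := by
      rw [Real.rpow_neg (by positivity), Real.rpow_two, div_pow, mul_pow,
        Real.sq_sqrt (by norm_num), Real.sq_sqrt hN0.le, inv_div]
    rw [this, ← Real.rpow_mul (by positivity)]
    congr 1; ring
  -- As `N ≥ 1`, the prefactor `2` is absorbed into the base; the final constant is `4√2 ≤ 6`.
  have e2 : (2 : ℝ) ≤ 4 ^ (N / 2) := by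
    have h4 : (4 : ℝ) = 2 ^ (2 : ℝ) := by norm_num
    rw [h4, ← Real.rpow_mul (by norm_num)]
    calc (2 : ℝ) = 2 ^ (1 : ℝ) := by simp
      _ ≤ _ := Real.rpow_le_rpow_of_exponent_le (by norm_num) (by linarith)
  have e3 : √2 ≤ 3 / 2 := Real.sqrt_le_iff.2 (by norm_num)
  rw [e1]
  calc (√2 * √N / S) ^ (N / 2) * (2 * (L / √N) ^ (N / 2))
      ≤ (√2 * √N / S) ^ (N / 2) * (4 ^ (N / 2) * (L / √N) ^ (N / 2)) := by gcongr
    _ = (√2 * √N / S * (4 * (L / √N))) ^ (N / 2) := by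
        rw [Real.mul_rpow (by positivity) (by positivity),
          Real.mul_rpow (by norm_num : (0 : ℝ) ≤ 4) (by positivity)]
    _ = (4 * √2 * L / S) ^ (N / 2) := by
        congr 1; field_simp
    _ ≤ (6 * L / S) ^ (N / 2) := by
        gcongr
        linarith

theorem LinearMap.lintegral_norm_rpow_neg_le {n : ℕ} {E F Ω : Type*}
    [NormedAddCommGroup E] [InnerProductSpace ℝ E] [FiniteDimensional ℝ E]
    [MeasurableSpace E] [BorelSpace E]
    [NormedAddCommGroup F] [InnerProductSpace ℝ F] [FiniteDimensional ℝ F]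
    (T : E →ₗ[ℝ] F) (b : OrthonormalBasis (Fin n) ℝ E)
    (hb : ∀ x, ‖T x‖ ^ 2 = ∑ i : Fin n, T.singularValues i ^ 2 * inner ℝ (b i) x ^ 2)
    [MeasurableSpace Ω] {P : Measure Ω} [IsProbabilityMeasure P] {X : Ω → E}
    (hX : AEMeasurable X P) {N m : ℕ} (hN : N ≠ 0) (hm : m ≤ n) {L S : ℝ} (hL : 0 < L) (hS : 0 < S)
    (hSN : S ^ 2 / (2 * N) ≤
      ∑ j ∈ Finset.range (m / N), T.singularValues ((j + 1) * N - 1) ^ 2)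
    (h : ∀ B : Finset (Fin n), B.card = N → ∀ ε : ℝ, 0 < ε →
      P.real {ω | √(∑ i ∈ B, inner ℝ (b i) (X ω) ^ 2) ≤ ε * √(B.card : ℝ)} ≤ (L * ε) ^ B.card) :
    (∀ᵐ ω ∂P, 0 < ‖T (X ω)‖) ∧
      ∫⁻ ω, ENNReal.ofReal (‖T (X ω)‖ ^ (-(N / 2 : ℝ))) ∂P ≤
        ENNReal.ofReal ((6 * L / S) ^ (N / 2 : ℝ)) := by
  have hN1 : (1 : ℝ) ≤ N := by exact_mod_cast Nat.one_le_iff_ne_zero.2 hN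
  have hN0 : (0 : ℝ) < N := by linarith
  set B : ℕ → Finset (Fin n) := fun j => Finset.univ.filter fun i : Fin n => (i : ℕ) / N = j
  have hcard : ∀ j ∈ Finset.range (m / N), (B j).card = N := fun j hj => by
    refine Fin.card_filter_div_eq hN (le_trans ?_ hm)
    exact (Nat.mul_le_mul_right N (Finset.mem_range.1 hj)).trans (Nat.div_mul_le_self m N)
  set Y : ℕ → Ω → ℝ := fun j ω => √(∑ i ∈ B j, inner ℝ (b i) (X ω) ^ 2)
  have hYm : ∀ j, AEMeasurable (Y j) P := fun j => by
    have : Measurable fun x : E => √(∑ i ∈ B j, inner ℝ (b i) x ^ 2) := by fun_prop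
    exact this.comp_aemeasurable hX
  have hsb : ∀ j ∈ Finset.range (m / N), ∀ ε : ℝ, 0 < ε →
      P.real {ω | Y j ω ≤ ε * √(N : ℝ)} ≤ (L * ε) ^ N := fun j hj ε hε => by
    have := h (B j) (hcard j hj) ε hε
    rwa [hcard j hj] at this
  have ha : Antitone fun i => T.singularValues i ^ 2 := fun i j hij =>
    pow_le_pow_left₀ (T.singularValues_nonneg j) (T.singularValues_antitone hij) 2
  obtain ⟨h1, h2⟩ := lintegral_rpow_neg_le_of_weighted_sum (P := P) (Finset.range (m / N))
    (fun j => T.singularValues ((j + 1) * N - 1) ^ 2) Y (fun ω => ‖T (X ω)‖)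
    (fun j _ => sq_nonneg _) (by positivity : 0 < S ^ 2 / (2 * N)) hSN
    (fun j _ => hYm j) (fun j hj => ae_pos_of_smallBall hN (hsb j hj))
    (fun ω => norm_nonneg _)
    (fun ω => by
      rw [hb]
      refine le_trans (le_of_eq ?_) (sum_blocks_le_sum ha (fun i => sq_nonneg _) N (m / N) hN
        (fun i => inner ℝ (b i) (X ω) ^ 2) fun i => sq_nonneg _)
      refine Finset.sum_congr rfl fun j _ => ?_
      rw [Real.sq_sqrt (Finset.sum_nonneg fun i _ => sq_nonneg _)])
    (by positivity : (0 : ℝ) < N / 2)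
    (fun j hj => lintegral_rpow_neg_le_of_smallBall (hYm j) (fun ω => Real.sqrt_nonneg _) hN hL
      (hsb j hj))
  refine ⟨h1, h2.trans ?_⟩
  rw [← ENNReal.ofReal_mul (Real.rpow_nonneg (by positivity) _)]
  exact ENNReal.ofReal_le_ofReal (negMoment_constant_le hL hS hN1)

theorem measureReal_le_of_lintegral_rpow_neg_le {Ω : Type*} [MeasurableSpace Ω] {P : Measure Ω}
    [IsProbabilityMeasure P] {V : Ω → ℝ} (hV : AEMeasurable V P) (hpos : ∀ᵐ ω ∂P, 0 < V ω)
    {A k : ℝ} (hA : 0 < A) (hk : 0 < k)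
    (h : ∫⁻ ω, ENNReal.ofReal (V ω ^ (-k)) ∂P ≤ ENNReal.ofReal (A ^ k)) {t : ℝ} (ht : 0 < t) :
    P.real {ω | V ω ≤ t} ≤ (A * t) ^ k := by
  have htk : 0 < t ^ (-k) := Real.rpow_pos_of_pos ht _
  have h1 := mul_meas_ge_le_lintegral₀ (hV.pow_const (-k)).ennreal_ofReal
    (ENNReal.ofReal (t ^ (-k)))
  have h2 : P {ω | V ω ≤ t} ≤
      P {ω | ENNReal.ofReal (t ^ (-k)) ≤ ENNReal.ofReal (V ω ^ (-k))} := by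
    refine measure_mono_ae (hpos.mono fun ω hω hle => ?_)
    exact ENNReal.ofReal_le_ofReal (Real.rpow_le_rpow_of_nonpos hω hle (by linarith))
  have h3 : ENNReal.ofReal (t ^ (-k)) * P {ω | V ω ≤ t} ≤ ENNReal.ofReal (A ^ k) :=
    (mul_le_mul_right h2 _).trans (h1.trans h)
  rw [← ofReal_measureReal, ← ENNReal.ofReal_mul htk.le,
    ENNReal.ofReal_le_ofReal_iff (Real.rpow_nonneg hA.le _), Real.rpow_neg ht.le,
    inv_mul_le_iff₀ (Real.rpow_pos_of_pos ht _)] at h3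
  rwa [mul_comm A, Real.mul_rpow ht.le hA.le]

/-- The `L^k` norm of `1/‖f‖` is nondecreasing in `k` on a probability space. Almost sure positivity
identifies the real power with the one in `[0, ∞]`, where `0 ^ (-k) = ∞`. -/
theorem ofReal_inv_le_negMoment {Ω E : Type*} [MeasurableSpace Ω] [NormedAddCommGroup E]
    {P : Measure Ω} [IsProbabilityMeasure P] {f : Ω → E} (hf : AEMeasurable (fun ω => ‖f ω‖ₑ) P)
    (hpos : ∀ᵐ ω ∂P, 0 < ‖f ω‖) {A k k' : ℝ} (hA : 0 < A) (hk' : 0 < k') (hkk : k' ≤ k)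
    (h : ∫⁻ ω, ENNReal.ofReal (‖f ω‖ ^ (-k)) ∂P ≤ ENNReal.ofReal (A ^ k)) :
    ENNReal.ofReal A⁻¹ ≤ (∫⁻ ω, ‖f ω‖ₑ ^ (-k') ∂P) ^ (-1 / k') := by
  have hk : 0 < k := hk'.trans_le hkk
  have hmono := eLpNorm'_le_eLpNorm'_of_exponent_le hk' hkk P
    (f := fun ω => ‖f ω‖ₑ⁻¹) hf.inv.aestronglyMeasurable
  simp only [eLpNorm', enorm_eq_self, ENNReal.inv_rpow, ← ENNReal.rpow_neg] at hmono
  have hle : (∫⁻ ω, ‖f ω‖ₑ ^ (-k) ∂P) ^ (1 / k) ≤ ENNReal.ofReal A := by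
    have e : ∫⁻ ω, ‖f ω‖ₑ ^ (-k) ∂P = ∫⁻ ω, ENNReal.ofReal (‖f ω‖ ^ (-k)) ∂P :=
      lintegral_congr_ae (hpos.mono fun ω hω => by
        simp only [← ofReal_norm]
        exact ENNReal.ofReal_rpow_of_pos hω)
    rw [e]
    refine (ENNReal.rpow_le_rpow h (by positivity)).trans_eq ?_
    rw [← ENNReal.ofReal_rpow_of_pos hA, ← ENNReal.rpow_mul, mul_one_div_cancel hk.ne',
      ENNReal.rpow_one]
  rw [ENNReal.ofReal_inv_of_pos hA, neg_div, ENNReal.rpow_neg]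
  exact ENNReal.inv_le_inv.2 (hmono.trans hle)

/-! ### Stable rank and the choice of block length -/

namespace SmallBall

theorem srankExponent_pos {q : ℝ≥0∞} (hq : 2 < q) : 0 < srankExponent q := by
  unfold srankExponent
  split_ifs with h
  · norm_num
  · have : (2 : ℝ) < q.toReal := by
      simpa using (ENNReal.toReal_lt_toReal (by simp) h).2 hq
    have : 0 < q.toReal - 2 := by linarith
    positivity

variable {n m : ℕ} (T : EuclideanSpace ℝ (Fin n) →ₗ[ℝ] EuclideanSpace ℝ (Fin m))

theorem schattenNorm_nonneg (q : ℝ≥0∞) : 0 ≤ schattenNorm T q := by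
  unfold schattenNorm
  split_ifs
  · exact T.singularValues_nonneg 0
  · exact Real.rpow_nonneg (Finset.sum_nonneg fun i _ =>
      Real.rpow_nonneg (T.singularValues_nonneg i) _) _

theorem srank_nonneg (q : ℝ≥0∞) : 0 ≤ srank q T :=
  Real.rpow_nonneg (div_nonneg (schattenNorm_nonneg T 2) (schattenNorm_nonneg T q)) _

theorem schattenNorm_rpow {q : ℝ≥0∞} (hq : q ≠ ∞) (hq0 : 0 < q.toReal) :
    schattenNorm T q ^ q.toReal = ∑ i ∈ Finset.range (Module.finrank ℝ (LinearMap.range T)),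
      T.singularValues i ^ q.toReal := by
  rw [schattenNorm, if_neg hq, ← Real.rpow_mul (Finset.sum_nonneg fun i _ =>
      Real.rpow_nonneg (T.singularValues_nonneg i) _), one_div_mul_cancel hq0.ne', Real.rpow_one]

theorem schattenNorm_two_sq :
    schattenNorm T 2 ^ 2 = ∑ i ∈ Finset.range (Module.finrank ℝ (LinearMap.range T)),
      T.singularValues i ^ 2 := by
  have := schattenNorm_rpow T (q := 2) (by simp) (by simp)
  simpa using this

theorem sum_range_singularValues_rpow_le {r : ℝ} (hr : r ≠ 0) (N : ℕ) :
    ∑ i ∈ Finset.range N, T.singularValues i ^ r ≤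
      ∑ i ∈ Finset.range (Module.finrank ℝ (LinearMap.range T)), T.singularValues i ^ r := by
  rcases le_total N (Module.finrank ℝ (LinearMap.range T)) with h | h
  · exact Finset.sum_le_sum_of_subset_of_nonneg (Finset.range_subset_range.2 h) fun i _ _ =>
      Real.rpow_nonneg (T.singularValues_nonneg i) _
  · refine le_of_eq (Finset.sum_subset (Finset.range_subset_range.2 h) fun i _ hi => ?_).symm
    rw [T.singularValues_eq_zero_iff_le_finrank_range.2 (by simpa using hi), Real.zero_rpow hr]

/-- Hölder's inequality on `N` terms; the exponent `2 / srankExponent q` equals `1 - 2/q`. -/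
theorem sum_range_sq_singularValues_le {q : ℝ≥0∞} (hq : 2 < q) (N : ℕ) :
    ∑ i ∈ Finset.range N, T.singularValues i ^ 2 ≤
      (N : ℝ) ^ (2 / srankExponent q) * schattenNorm T q ^ 2 := by
  by_cases hq' : q = ∞
  · simp only [srankExponent, schattenNorm, hq', if_true]
    rw [div_self two_ne_zero, Real.rpow_one]
    calc ∑ i ∈ Finset.range N, T.singularValues i ^ 2
        ≤ ∑ i ∈ Finset.range N, T.singularValues 0 ^ 2 := Finset.sum_le_sum fun i _ =>
          pow_le_pow_left₀ (T.singularValues_nonneg i) (T.singularValues_antitone (Nat.zero_le i)) 2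
      _ = _ := by simp
  · have hr : (2 : ℝ) < q.toReal := by
      simpa using (ENNReal.toReal_lt_toReal (by simp) hq').2 hq
    have hQ := schattenNorm_rpow T hq' (by linarith)
    have hQ0 := schattenNorm_nonneg T q
    have hhead := sum_range_singularValues_rpow_le T (r := q.toReal) (by linarith) N
    rw [← hQ] at hhead
    simp only [srankExponent, hq', if_false]
    set r := q.toReal
    set Q := schattenNorm T q
    have hp : 0 < r / 2 := by linarith
    rw [← Real.rpow_le_rpow_iff (Finset.sum_nonneg fun i _ => sq_nonneg _)
      (mul_nonneg (Real.rpow_nonneg (Nat.cast_nonneg N) _) (sq_nonneg _)) hp]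
    have key := Real.rpow_sum_le_const_mul_sum_rpow_of_nonneg (Finset.range N)
      (f := fun i => T.singularValues i ^ 2) (p := r / 2) (by linarith) (fun i _ => sq_nonneg _)
    have hpow : ∀ x : ℝ, 0 ≤ x → (x ^ 2) ^ (r / 2) = x ^ r := fun x hx => by
      rw [← Real.rpow_natCast, ← Real.rpow_mul hx]
      congr 1; push_cast; ring
    simp only [hpow _ (T.singularValues_nonneg _), Finset.card_range] at key
    refine key.trans ?_
    rw [Real.mul_rpow (Real.rpow_nonneg (Nat.cast_nonneg N) _) (sq_nonneg _), hpow _ hQ0,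
      ← Real.rpow_mul (Nat.cast_nonneg N)]
    have he : 2 / (2 * r / (r - 2)) * (r / 2) = r / 2 - 1 := by
      have : r - 2 ≠ 0 := by linarith
      field_simp
    rw [he]
    exact mul_le_mul_of_nonneg_left hhead (Real.rpow_nonneg (Nat.cast_nonneg N) _)

/-- A number `N` of singular values proportional to the stable rank that carry at most half of
the Hilbert–Schmidt norm, unless `N = 1`; in both cases consecutive blocks of length `N` have a
large sum of minima. -/
theorem exists_block_length {q : ℝ≥0∞} (hq : 2 < q) (hS : 0 < schattenNorm T 2) :
    ∃ N : ℕ, N ≠ 0 ∧ (N = 1 ∨ N < Module.finrank ℝ (LinearMap.range T)) ∧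
      (1 / 2) ^ (srankExponent q / 2) / 4 * srank q T ≤ (N / 2 : ℝ) ∧
      schattenNorm T 2 ^ 2 / (2 * N) ≤
        ∑ j ∈ Finset.range (Module.finrank ℝ (LinearMap.range T) / N),
          T.singularValues ((j + 1) * N - 1) ^ 2 := by
  have he := srankExponent_pos hq
  have hS2 := schattenNorm_two_sq T
  have hQ0 := schattenNorm_nonneg T q
  set m' := Module.finrank ℝ (LinearMap.range T)
  set e := srankExponent q
  -- Chosen so that `(κ * srank q T) ^ (2 / e) = ‖T‖²_{S₂} / (2 ‖T‖²_{S_q})`, which turns the Hölder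
  -- bound into half of `‖T‖²_{S₂}`.
  set κ : ℝ := (1 / 2) ^ (e / 2) with hκ
  by_cases hlt : κ * srank q T < 1
  · refine ⟨1, one_ne_zero, Or.inl rfl, ?_, ?_⟩
    · push_cast; linarith
    · simp only [Nat.div_one, mul_one, Nat.add_sub_cancel, Nat.cast_one]
      rw [← hS2]
      linarith [sq_nonneg (schattenNorm T 2)]
  · rw [not_lt] at hlt
    set N := ⌊κ * srank q T⌋₊ with hNdef
    have hN1 : 1 ≤ N := Nat.le_floor (by simpa using hlt)
    have hN0 : N ≠ 0 := by omega
    have hNle : (N : ℝ) ≤ κ * srank q T := Nat.floor_le (by linarith)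
    have hNlt : κ * srank q T < N + 1 := Nat.lt_floor_add_one _
    have hN1' : (1 : ℝ) ≤ N := by exact_mod_cast hN1
    have hQ : 0 < schattenNorm T q := hQ0.lt_of_ne' fun h0 => by
      rw [srank, h0, div_zero, Real.zero_rpow he.ne', mul_zero] at hlt
      linarith
    have hsr : κ * srank q T = (schattenNorm T 2 ^ 2 / (2 * schattenNorm T q ^ 2)) ^ (e / 2) := by
      have h1 : srank q T = ((schattenNorm T 2 / schattenNorm T q) ^ 2) ^ (e / 2) := by
        rw [srank, ← Real.rpow_natCast, ← Real.rpow_mul (by positivity)]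
        congr 1; push_cast; ring
      rw [h1, hκ, ← Real.mul_rpow (by norm_num) (by positivity)]
      congr 1
      field_simp
    have hNpow : (N : ℝ) ^ (2 / e) ≤ schattenNorm T 2 ^ 2 / (2 * schattenNorm T q ^ 2) := by
      have := Real.rpow_le_rpow (Nat.cast_nonneg N) hNle (by positivity : 0 ≤ 2 / e)
      rw [hsr, ← Real.rpow_mul (by positivity)] at this
      rwa [show e / 2 * (2 / e) = 1 by field_simp, Real.rpow_one] at this
    have hhead : ∑ i ∈ Finset.range N, T.singularValues i ^ 2 ≤ schattenNorm T 2 ^ 2 / 2 := by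
      refine (sum_range_sq_singularValues_le T hq N).trans
        ((mul_le_mul_of_nonneg_right hNpow (sq_nonneg _)).trans_eq ?_)
      field_simp
    have hpos2 : 0 < schattenNorm T 2 ^ 2 := by positivity
    -- The factor `1/4` enters here: `κ * srank q T < N + 1 ≤ 2N`.
    refine ⟨N, hN0, Or.inr ?_, by linarith, ?_⟩
    · by_contra! hcon
      have : ∑ i ∈ Finset.range m', T.singularValues i ^ 2 ≤
          ∑ i ∈ Finset.range N, T.singularValues i ^ 2 :=
        Finset.sum_le_sum_of_subset_of_nonneg (Finset.range_subset_range.2 hcon)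
          fun i _ _ => sq_nonneg _
      linarith
    · have ha : Antitone fun i => T.singularValues i ^ 2 := fun i j hij =>
        pow_le_pow_left₀ (T.singularValues_nonneg j) (T.singularValues_antitone hij) 2
      have := sum_range_le_sum_head_add_div_blocks ha (fun i => sq_nonneg _) N m' hN0
      rw [← Finset.mul_sum, ← hS2] at this
      rw [div_le_iff₀ (by positivity)]
      linarith

theorem schattenNorm_two_pos (h : 1 ≤ Module.finrank ℝ (LinearMap.range T)) :
    0 < schattenNorm T 2 := by
  refine (schattenNorm_nonneg T 2).lt_of_ne' fun h0 => ?_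
  have h2 := schattenNorm_two_sq T
  rw [h0, zero_pow two_ne_zero] at h2
  have h3 := (Finset.sum_eq_zero_iff_of_nonneg fun i _ => sq_nonneg _).1 h2.symm 0
    (Finset.mem_range.2 h)
  exact (T.singularValues_pos_iff_lt_finrank_range.2 h).ne' (pow_eq_zero_iff two_ne_zero |>.1 h3)

end SmallBall

/-! ### The theorem -/

theorem theorem1p8 :
    ∃ c c' : ℝ, 0 < c ∧ 0 < c' ∧
      ∀ q : ℝ≥0∞, 2 < q → ∃ cq cq' : ℝ, 0 < cq ∧ 0 < cq' ∧
        ∀ (n m : ℕ) (T : EuclideanSpace ℝ (Fin n) →ₗ[ℝ] EuclideanSpace ℝ (Fin m)),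
          1 ≤ m → Module.finrank ℝ (LinearMap.range T) = m →
            (∀ k : ℝ, 0 < k → k ≤ cq * SmallBall.srank q T →
              ENNReal.ofReal (c * SmallBall.schattenNorm T 2) ≤
                SmallBall.gaussianNegMoment T k) ∧
            (2 ≤ n → ∀ {Ω : Type*} [MeasurableSpace Ω] (P : Measure Ω) [IsProbabilityMeasure P]
              (X : Ω → EuclideanSpace ℝ (Fin n)) (L : ℝ),
              AEMeasurable X P → 0 < L → SmallBall.SBA P X L →
                ∀ ε : ℝ, 0 < ε →
                  P.real {ω | ‖T (X ω)‖ ≤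
                      ε / (2 * Real.exp 1 * L) * SmallBall.schattenNorm T 2} ≤
                    (c' * ε) ^ (cq' * SmallBall.srank q T)) := by
  -- The Gaussian small ball constant is `√e`; in the second part `6L · ε/(2eL) = 3ε/e ≤ 3ε`.
  refine ⟨(6 * √(Real.exp 1))⁻¹, 3, by positivity, by norm_num, fun q hq => ?_⟩
  have hκ : (0 : ℝ) < (1 / 2) ^ (SmallBall.srankExponent q / 2) / 4 := by positivity
  refine ⟨_, _, hκ, hκ, fun n m T hm hrank => ?_⟩
  have hS := SmallBall.schattenNorm_two_pos T (hrank.symm ▸ hm)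
  obtain ⟨N, hN0, hNm, hNk, hsum⟩ := SmallBall.exists_block_length T hq hS
  rw [hrank] at hNm hsum
  have hmn : m ≤ n := by
    have := LinearMap.finrank_range_le T
    rwa [hrank, finrank_euclideanSpace_fin] at this
  obtain ⟨b, hb⟩ := T.exists_orthonormalBasis_norm_sq_apply
    (finrank_euclideanSpace_fin (𝕜 := ℝ) (n := n))
  have hTc : Continuous T := T.continuous_of_finiteDimensional
  have hk : (0 : ℝ) < N / 2 := by positivity
  set S := SmallBall.schattenNorm T 2
  refine ⟨fun k hk0 hkle => ?_, fun hn Ω _ P _ X L hX hL hSBA ε hε => ?_⟩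
  · obtain ⟨h1, h2⟩ := T.lintegral_norm_rpow_neg_le b hb
      (P := stdGaussian (EuclideanSpace ℝ (Fin n))) (X := fun x => x) aemeasurable_id hN0 hmn
      (L := √(Real.exp 1)) (by positivity) hS hsum
      fun B _ ε hε => stdGaussian_smallBall b B hε
    have h3 := ofReal_inv_le_negMoment (by fun_prop) h1 (by positivity) hk0 (hkle.trans hNk) h2
    rwa [inv_div, div_eq_inv_mul] at h3
  · obtain ⟨h1, h2⟩ := T.lintegral_norm_rpow_neg_le b hb hX hN0 hmn hL hS hsum
      -- The SBA excludes the full dimension; `N < n` since either `N = 1 < 2 ≤ n` or `N < m ≤ n`.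
      fun B hB ε hε => hSBA.coordinates b B (by omega) (by omega) hε
    have hle := measureReal_le_of_lintegral_rpow_neg_le
      (hTc.norm.measurable.comp_aemeasurable hX) h1 (by positivity) hk h2
      (t := ε / (2 * Real.exp 1 * L) * S) (by positivity)
    -- For `3ε ≥ 1` the bound is at least `1`; for `3ε < 1` the exponent `N/2` may be lowered to the
    -- multiple of the stable rank.
    rcases le_or_gt 1 (3 * ε) with h3 | h3
    · exact measureReal_le_one.trans
        (Real.one_le_rpow h3 (mul_nonneg hκ.le (SmallBall.srank_nonneg T q)))
    · refine hle.trans ((Real.rpow_le_rpow (by positivity) ?_ hk.le).trans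
        (Real.rpow_le_rpow_of_exponent_ge (by positivity) h3.le hNk))
      have : 6 * L / S * (ε / (2 * Real.exp 1 * L) * S) = 3 * ε / Real.exp 1 := by
        field_simp; norm_num
      rw [this]
      exact div_le_self (by positivity) (Real.one_le_exp zero_le_one)
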